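/- Let $L_x,L_y\ge 1$. The periodic $L_x\times L_y$ Lieb lattice has a $d$ orbital at each vertex $R\in\mathbb Z/L_x\times\mathbb Z/L_y$ and a $p$ orbital at the midpoint $R+\hat\delta/2$ of each bond from $R$ to $R+\hat\delta$, for $\delta\in\{x,y\}$. A configuration of $N$ distinguishable electrons is an $N$-tuple $(r_1,\dots,r_N)$ of pairwise distinct orbitals that contains every $d$ orbital; each electron also carries a spin $\sigma_i\in\{\uparrow,\downarrow\}$. Consider the Hamiltonian $$T=-t\sum_{R}\sum_{\delta=x,y}\ \sum_{\sigma,\sigma'=\uparrow,\downarrow}\Big(d^\dagger_{R,\sigma}\,p^\dagger_{R+\hat\delta/2,\sigma'}\,d_{R,\sigma'}\,p_{R-\hat\delta/2,\sigma}+\mathrm{H.c.}\Big)$$ (with $t\neq0$) under the constraint that no orbital is doubly occupied. Its terms act on configurations as follows: if an electron of spin $\sigma$ is on $R-\hat\delta/2$, an electron of spin $\sigma'$ is on $R$, and $R+\hat\delta/2$ is empty, then the first electron moves to $R$ and the second one to $R+\hat\delta/2$, each keeping its spin and all other electrons staying fixed (otherwise the configuration is annihilated); the Hermitian conjugate term is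 the reverse process. A permutation $\pi\in S_N$ is induced from $(r_i)$ if $(r_{\pi(i)})$ can be reached from $(r_i)$ by finitely many (possibly zero) applications of such terms. For a configuration, let $X(y)$ be the number of electrons on the $x$-bonds of row $y$ and $Y(x)$ the number of electrons on the $y$-bonds of column $x$. Suppose that for all $y\in\mathbb Z/L_y$ and all $x\in\mathbb Z/L_x$ (a) $L_x+X(y)$ and $L_y+Y(x)$ are odd, and (b) $0<X(y)<L_x$ and $0<Y(x)<L_y$. Then the dynamics is even-permutation-ergodic for this configuration: for every choice of the spins $(\sigma_i)$ and every $\pi\in S_N$, the permutation $\pi$ is induced from $(r_i)$ if and only if $\pi$ is even. -/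

import Mathlib

/-!
# Correlated hopping of distinguishable electrons on a periodic Lieb lattice
-/

namespace LiebLattice

/-- The two bond directions (flavors). -/
inductive Dir
  | x
  | y
  deriving DecidableEq

/-- The two spin states of an electron. -/
inductive Spin
  | up
  | down
  deriving DecidableEq

/-- Vertices of the `Lx × Ly` square lattice with periodic boundary condition. -/
abbrev Vertex (Lx Ly : ℕ) : Type := ZMod Lx × ZMod Ly

/-- The lattice unit vector in direction `δ`. -/
def unit {Lx Ly : ℕ} : Dir → Vertex Lx Ly
  | .x => (1, 0)
  | .y => (0, 1)

/-- Orbitals of the periodic Lieb lattice: `d R` sits at the vertex `R`, and `p δ R` sits on the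
bond from `R` to `R + unit δ`, that is, at `R + δ/2`. -/
inductive Site (Lx Ly : ℕ)
  | d (R : Vertex Lx Ly)
  | p (δ : Dir) (R : Vertex Lx Ly)
  deriving DecidableEq

/-- The `p` orbital at `R + δ/2`. -/
def pAhead {Lx Ly : ℕ} (δ : Dir) (R : Vertex Lx Ly) : Site Lx Ly := .p δ R

/-- The `p` orbital at `R - δ/2`. -/
def pBehind {Lx Ly : ℕ} (δ : Dir) (R : Vertex Lx Ly) : Site Lx Ly := .p δ (R - unit δ)

/-- A configuration of `N` distinguishable (Boltzmannian) electrons: the tuple of their positions.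
No orbital is doubly occupied, and every `d` orbital is (singly) occupied. -/
@[ext]
structure Config (Lx Ly N : ℕ) where
  pos : Fin N → Site Lx Ly
  injective : Function.Injective pos
  d_filled : ∀ R : Vertex Lx Ly, ∃ i, pos i = .d R

namespace Config

variable {Lx Ly N : ℕ}

/-- The permuted configuration `(r_{π(i)})`. -/
def permute (c : Config Lx Ly N) (π : Equiv.Perm (Fin N)) : Config Lx Ly N where
  pos i := c.pos (π i)
  injective := c.injective.comp π.injective
  d_filled R := by
    obtain ⟨i, hi⟩ := c.d_filled R
    exact ⟨π.symm i, by simpa using hi⟩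

/-- The number of electrons on the orbital `s`. -/
def occupation (c : Config Lx Ly N) (s : Site Lx Ly) : ℕ :=
  (Finset.univ.filter fun i => c.pos i = s).card

/-- `X(y)`: the number of electrons on the `x`-bonds of row `y`. -/
def X [NeZero Lx] (c : Config Lx Ly N) (y : ZMod Ly) : ℕ :=
  ∑ x : ZMod Lx, c.occupation (.p .x (x, y))

/-- `Y(x)`: the number of electrons on the `y`-bonds of column `x`. -/
def Y [NeZero Ly] (c : Config Lx Ly N) (x : ZMod Lx) : ℕ :=
  ∑ y : ZMod Ly, c.occupation (.p .y (x, y))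

end Config

/-- Labels of the terms of the Hamiltonian: the label `(R, δ, σ, σ', false)` stands for
`d†_{R,σ} p†_{R+δ/2,σ'} d_{R,σ'} p_{R-δ/2,σ}`, and `(R, δ, σ, σ', true)` for its Hermitian
conjugate. -/
structure HoppingTerm (Lx Ly : ℕ) where
  R : Vertex Lx Ly
  δ : Dir
  σ : Spin
  σ' : Spin
  conj : Bool

section Dynamics

variable {Lx Ly N : ℕ}

/-- The term `d†_{R,σ} p†_{R+δ/2,σ'} d_{R,σ'} p_{R-δ/2,σ}` takes the positions `c` to `c'` when the
spins of the electrons are `s`: an electron `i` of spin `σ` on `R - δ/2` moves to `R`, while the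
electron `j` of spin `σ'` on `R` moves to the orbital `R + δ/2`, which has to be empty. Each
electron carries its spin along. -/
def ForwardHop (R : Vertex Lx Ly) (δ : Dir) (σ σ' : Spin) (s : Fin N → Spin)
    (c c' : Config Lx Ly N) : Prop :=
  ∃ i j : Fin N,
    c.pos i = pBehind δ R ∧ s i = σ ∧
    c.pos j = .d R ∧ s j = σ' ∧
    (∀ k, c.pos k ≠ pAhead δ R) ∧
    c'.pos i = .d R ∧ c'.pos j = pAhead δ R ∧
    ∀ k, k ≠ i → k ≠ j → c'.pos k = c.pos k

/-- The term `h` takes the configuration `c` to `c'` when the spins of the electrons are `s`;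
a Hermitian conjugate acts as the reverse process. -/
def HoppingTerm.Maps (h : HoppingTerm Lx Ly) (s : Fin N → Spin) (c c' : Config Lx Ly N) : Prop :=
  if h.conj then ForwardHop h.R h.δ h.σ h.σ' s c' c else ForwardHop h.R h.δ h.σ h.σ' s c c'

/-- `c'` arises from `c` by finitely many (possibly no) applications of terms of the Hamiltonian. -/
def Connected (s : Fin N → Spin) : Config Lx Ly N → Config Lx Ly N → Prop :=
  Relation.ReflTransGen fun c c' => ∃ h : HoppingTerm Lx Ly, h.Maps s c c'

/-- The dynamics is even-permutation-ergodic for `c`: whatever the spins, the permutations of the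
electrons that it induces from `c` are exactly the even ones. -/
def EvenPermutationErgodic (c : Config Lx Ly N) : Prop :=
  ∀ (s : Fin N → Spin) (π : Equiv.Perm (Fin N)),
    Connected s c (c.permute π) ↔ Equiv.Perm.sign π = 1

end Dynamics

end LiebLattice

/-! Only even permutations occur because of a conserved sign. Order the orbitals with all `d`
orbitals first and then the bonds line by line (`key`). `Config.gauge` is the sign of the order of
the electrons in this list, times (-1)^position for each occupied bond. A hop inside a line carries
an electron past no other electron of its line; the sign -1 from the exchange of roles at the vertex
is cancelled by the shift of one position. A hop across the periodic boundary passes the n - 1 other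
electrons of the line and shifts the position by L - 1, so its total sign is (-1)^(L + n - 1), which
is 1 exactly when L + n is odd. Hence the gauge is conserved (`ForwardHop.gauge_eq`,
`Connected.conserved`), while a permutation multiplies it by its sign.

All even permutations occur because three-cycles abound. If hops in both directions are possible at
a vertex, their commutator is a three-cycle of the three electrons involved (`exists_isThreeCycle`).
Each line holds both electrons and vacancies, so either can be brought next to a given vertex
without disturbing what is already in place (`Mixed.exists_transport`). Thus every electron on a
bond shares a three-cycle with the electron at each end (`linked_bond`), and electrons on
neighboring vertices are joined by chains of three-cycles (`reflTransGen_linked_neighbor`). A group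
whose three-cycles connect all points is primitive, and Jordan's theorem makes it contain the
alternating group (`alternatingGroup_le_of_linked`). -/

namespace LiebLattice

/-! ### Permutation groups connected by three-cycles -/

section ThreeCycles

open Equiv Equiv.Perm MulAction
open scoped Pointwise

variable {α : Type*} [Fintype α] [DecidableEq α]

/-- Two points are linked by `G` if a single three-cycle of `G` moves both of them. -/
def Linked (G : Subgroup (Perm α)) (a b : α) : Prop :=
  ∃ g ∈ G, g.IsThreeCycle ∧ g a ≠ a ∧ g b ≠ b

theorem Linked.symm {G : Subgroup (Perm α)} {a b : α} (h : Linked G a b) : Linked G b a := by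
  obtain ⟨g, hg, h3, ha, hb⟩ := h
  exact ⟨g, hg, h3, hb, ha⟩

theorem Linked.exists_apply_eq {G : Subgroup (Perm α)} {a b : α} (h : Linked G a b) :
    ∃ g ∈ G, g a = b := by
  obtain ⟨g, hg, h3, ha, hb⟩ := h
  obtain ⟨n, hn⟩ := h3.isCycle.exists_zpow_eq ha hb
  exact ⟨g ^ n, G.zpow_mem hg n, hn⟩

/-- A second point of the block is either fixed by the three-cycle or lies on it together with `a`.
In both cases the three-cycle sends some point of the block into the block, so it preserves the
block, and its powers carry `a` to `b`. -/
theorem Linked.mem_of_isBlock {G : Subgroup (Perm α)} {B : Set α} (hB : IsBlock G B)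
    (hns : ¬ B.Subsingleton) {a b : α} (h : Linked G a b) (ha : a ∈ B) : b ∈ B := by
  obtain ⟨g, hg, h3, hga, hgb⟩ := h
  have hz : ∃ z ∈ B, g z ∈ B := by
    obtain ⟨a', ha', hne⟩ : ∃ a' ∈ B, a' ≠ a := by
      by_contra! hcon
      exact hns fun x hx y hy => (hcon x hx).trans (hcon y hy).symm
    by_cases hfix : g a' = a'
    · exact ⟨a', ha', by rwa [hfix]⟩
    · obtain ⟨n, hn⟩ := h3.isCycle.exists_zpow_eq hga hfix
      rw [← zpow_mod_orderOf, h3.orderOf] at hn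
      have h0 : 0 ≤ n % ((3 : ℕ) : ℤ) := Int.emod_nonneg _ (by norm_num)
      have h1 : n % ((3 : ℕ) : ℤ) < 3 := Int.emod_lt_of_pos _ (by norm_num)
      generalize n % ((3 : ℕ) : ℤ) = m at hn h0 h1
      -- The exponents 0, 1, 2 mean `a' = a` (excluded), `g a = a'` and `g a' = a`.
      interval_cases m
      · exact absurd hn.symm (by simpa using hne)
      · exact ⟨a, ha, by simpa using hn ▸ ha'⟩
      · refine ⟨a', ha', ?_⟩
        have h33 : (g ^ 3) a = a := by rw [← h3.orderOf, pow_orderOf_eq_one]; rfl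
        have : g a' = a := by
          rw [← hn]
          exact h33
        rwa [this]
  obtain ⟨z, hz, hgz⟩ := hz
  let g' : G := ⟨g, hg⟩
  have hstab : g' • B = B := by
    by_contra hcon
    have hd := hB (g₁ := g') (g₂ := 1) (by simpa using hcon)
    rw [one_smul] at hd
    exact Set.disjoint_left.mp hd (Set.smul_mem_smul_set (a := g') hz) hgz
  obtain ⟨n, hn⟩ := h3.isCycle.exists_zpow_eq hga hgb
  have hmem : g' ∈ stabilizer G B := hstab
  have hpow : g' ^ n • B = B := (stabilizer G B).zpow_mem hmem n
  have := Set.smul_mem_smul_set (a := g' ^ n) ha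
  rw [hpow] at this
  rw [← hn]
  exact this

/-- A permutation group whose three-cycles link all points contains all even permutations. -/
theorem alternatingGroup_le_of_linked (G : Subgroup (Perm α))
    (h : ∀ a b, Relation.ReflTransGen (Linked G) a b) : alternatingGroup α ≤ G := by
  rcases subsingleton_or_nontrivial α with hα | ⟨a, b, hab⟩
  · intro π _
    rw [Subsingleton.elim π 1]
    exact G.one_mem
  · obtain ⟨g, hg, h3, -⟩ : ∃ g ∈ G, g.IsThreeCycle ∧ True := by
      rcases (h a b).cases_head with heq | ⟨c, ⟨g, hg, h3, -⟩, -⟩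
      · exact absurd heq hab
      · exact ⟨g, hg, h3, trivial⟩
    -- Jordan's theorem; transitivity and the absence of nontrivial blocks remain.
    refine alternatingGroup_le_of_isPreprimitive_of_isThreeCycle_mem ?_ h3 hg
    refine @IsPreprimitive.mk _ _ _ ⟨fun x y => ?_⟩ fun {B} hB => ?_
    · induction h x y with
      | refl => exact ⟨1, one_smul _ _⟩
      | tail _ hl ih =>
        obtain ⟨g₁, h₁⟩ := ih
        obtain ⟨g₂, hg₂, h₂⟩ := hl.exists_apply_eq
        exact ⟨⟨g₂, hg₂⟩ * g₁, by rw [mul_smul, h₁]; exact h₂⟩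
    · by_cases hs : B.Subsingleton
      · exact Or.inl hs
      · refine Or.inr (Set.eq_univ_of_forall fun y => ?_)
        obtain ⟨x, hx⟩ : B.Nonempty := (Set.not_subsingleton_iff.mp hs).nonempty
        induction h x y with
        | refl => exact hx
        | tail _ hl ih => exact hl.mem_of_isBlock hB hs ih

end ThreeCycles

/-! ### Signs of orderings and their change under moves -/

section PairProducts

variable {N : ℕ}

/-- A product over pairs with a symmetric factor that is trivial away from `i`. -/
theorem prod_pairs_eq_prod_erase {r : Fin N → Fin N → ℤ} (i : Fin N)
    (hsymm : ∀ p q, r p q = r q p) (h : ∀ p q, p ≠ i → q ≠ i → p ≠ q → r p q = 1) :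
    ∏ p, ∏ q ∈ Finset.Ioi p, r p q = ∏ k ∈ Finset.univ.erase i, r k i := by
  rw [← Finset.mul_prod_erase _ _ (Finset.mem_univ i)]
  have hin : ∀ p ∈ Finset.univ.erase i,
      ∏ q ∈ Finset.Ioi p, r p q = if p < i then r p i else 1 := by
    intro p hp
    have hpi := Finset.ne_of_mem_erase hp
    split_ifs with hlt
    · refine Finset.prod_eq_single_of_mem i (Finset.mem_Ioi.mpr hlt) fun q hq hqi => ?_
      exact h p q hpi hqi (Finset.mem_Ioi.mp hq).ne
    · refine Finset.prod_eq_one fun q hq => ?_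
      have hpq := Finset.mem_Ioi.mp hq
      refine h p q hpi ?_ hpq.ne
      rintro rfl
      exact hlt hpq
  rw [Finset.prod_congr rfl hin,
    ← Finset.prod_filter_mul_prod_filter_not (Finset.univ.erase i) (fun k => k < i) (fun k => r k i),
    Finset.prod_ite, Finset.prod_const_one, mul_one, mul_comm]
  congr 1
  refine Finset.prod_congr ?_ fun q _ => hsymm _ _
  ext q
  simp only [Finset.mem_Ioi, Finset.mem_filter, Finset.mem_erase, Finset.mem_univ, and_true, not_lt]
  constructor
  · exact fun hq => ⟨hq.ne', hq.le⟩
  · exact fun hq => lt_of_le_of_ne hq.2 hq.1.symm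

end PairProducts

section Orientation

variable {β γ : Type*} [LinearOrder γ]

/-- The sign of the comparison of `a` and `b` through `key`. -/
def orient (key : β → γ) (a b : β) : ℤ :=
  if key a < key b then 1 else if key b < key a then -1 else 0

theorem orient_antisymm (key : β → γ) (a b : β) : orient key a b = -orient key b a := by
  unfold orient
  rcases lt_trichotomy (key a) (key b) with h | h | h
  · simp [h, h.not_gt]
  · simp [h]
  · simp [h, h.not_gt]

theorem orient_of_lt {key : β → γ} {a b : β} (h : key a < key b) : orient key a b = 1 := by
  simp [orient, h]

theorem orient_of_gt {key : β → γ} {a b : β} (h : key b < key a) : orient key a b = -1 := by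
  simp [orient, h, h.not_gt]

theorem orient_mul_self {key : β → γ} (hkey : Function.Injective key) {a b : β} (h : a ≠ b) :
    orient key a b * orient key a b = 1 := by
  rcases lt_or_gt_of_ne (hkey.ne h) with h | h
  · simp [orient_of_lt h]
  · simp [orient_of_gt h]

variable {N : ℕ}

/-- The sign of the order in which `key` arranges the points of a tuple. -/
def orientation (key : β → γ) (f : Fin N → β) : ℤ :=
  ∏ p, ∏ q ∈ Finset.Ioi p, orient key (f p) (f q)

theorem orientation_comp_perm (key : β → γ) (f : Fin N → β) (π : Equiv.Perm (Fin N)) :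
    orientation key (f ∘ π) = Equiv.Perm.sign π * orientation key f :=
  π.prod_Ioi_comp_eq_sign_mul_prod (f := fun i j => orient key (f i) (f j))
    fun _ _ => orient_antisymm _ _ _

theorem orientation_mul_self {key : β → γ} (hkey : Function.Injective key) {f : Fin N → β}
    (hf : Function.Injective f) : orientation key f * orientation key f = 1 := by
  unfold orientation
  rw [← Finset.prod_mul_distrib]
  refine Finset.prod_eq_one fun p _ => ?_
  rw [← Finset.prod_mul_distrib]
  refine Finset.prod_eq_one fun q hq => ?_
  exact orient_mul_self hkey (hf.ne (Finset.mem_Ioi.mp hq).ne)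

/-- A pair avoiding `i` contributes the square of a sign, so only the pairs containing `i` survive.
-/
theorem orientation_mul_orientation {key : β → γ} (hkey : Function.Injective key)
    {f g : Fin N → β} (hf : Function.Injective f) (i : Fin N) (hfg : ∀ k, k ≠ i → g k = f k) :
    orientation key f * orientation key g
      = ∏ k ∈ Finset.univ.erase i, orient key (f k) (f i) * orient key (f k) (g i) := by
  unfold orientation
  simp_rw [← Finset.prod_mul_distrib]
  rw [prod_pairs_eq_prod_erase i]
  · refine Finset.prod_congr rfl fun k hk => ?_
    rw [hfg k (Finset.ne_of_mem_erase hk)]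
  · intro p q
    rw [orient_antisymm key (f p), orient_antisymm key (g p)]
    ring
  · intro p q hp hq hpq
    rw [hfg p hp, hfg q hq]
    exact orient_mul_self hkey (hf.ne hpq)

/-- If the point labelled `j` moves from `d` to a free point `b'` and then the point labelled `i`
moves from `b` to `d`, where `d` lies below `b` and `b'`, the orientation changes by the number of
the other points which separate `b` from `b'`, plus one. -/
theorem orientation_push {key : β → γ} (hkey : Function.Injective key) {f f' : Fin N → β}
    (hf : Function.Injective f) {i j : Fin N} (hij : i ≠ j) {b' : β} (hb' : ∀ k, f k ≠ b')
    (hi : f' i = f j) (hj : f' j = b') (hk : ∀ k, k ≠ i → k ≠ j → f' k = f k)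
    (h1 : key (f j) < key (f i)) (h2 : key (f j) < key b') :
    orientation key f * orientation key f'
      = -∏ k ∈ (Finset.univ.erase i).erase j, orient key (f k) (f i) * orient key (f k) b' := by
  -- The intermediate tuple has `j` already moved and `i` not yet, so each half moves a single point
  -- and stays injective.
  set g := Function.update f j b' with hg
  have hgj : g j = b' := by simp [hg]
  have hgk : ∀ k, k ≠ j → g k = f k := fun k hk => by simp [hg, hk]
  have hginj : Function.Injective g := by
    intro p q hpq
    by_cases hp : p = j <;> by_cases hq : q = j
    · rw [hp, hq]
    · rw [hp, hgj, hgk q hq] at hpq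
      exact absurd hpq.symm (hb' q)
    · rw [hq, hgj, hgk p hp] at hpq
      exact absurd hpq (hb' p)
    · rw [hgk p hp, hgk q hq] at hpq
      exact hf hpq
  have e1 := orientation_mul_orientation hkey hf j hgk
  have e2 := orientation_mul_orientation hkey hginj (g := f') i (fun k hki => by
    by_cases hkj : k = j
    · rw [hkj, hj, hgj]
    · rw [hk k hki hkj, hgk k hkj])
  have e3 := orientation_mul_self hkey hginj
  rw [← Finset.mul_prod_erase _ _ (Finset.mem_erase.mpr ⟨hij, Finset.mem_univ i⟩)] at e1
  rw [← Finset.mul_prod_erase _ _ (Finset.mem_erase.mpr ⟨hij.symm, Finset.mem_univ j⟩)] at e2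
  rw [hgj, hgk i hij, hi, orient_of_gt h2, orient_antisymm key b' (f i)] at e2
  rw [hgj, orient_of_gt h1] at e1
  have e4 : orientation key f * orientation key f'
      = (orientation key f * orientation key g) * (orientation key g * orientation key f') := by
    calc _ = orientation key f * orientation key f' * 1 := by ring
      _ = _ := by rw [← e3]; ring
  have e5 : orient key (f i) b' * orient key (f i) b' = 1 := orient_mul_self hkey (hb' i)
  have e6 : ((Finset.univ.erase j).erase i : Finset (Fin N)) = (Finset.univ.erase i).erase j :=
    Finset.erase_right_comm
  -- The comparisons with the vertex orbital occur once in each half and square to one.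
  have e7 : ∏ k ∈ (Finset.univ.erase i).erase j, orient key (f k) (f i) * orient key (f k) b'
      = (∏ k ∈ (Finset.univ.erase i).erase j, orient key (f k) (f j) * orient key (f k) b') *
        ∏ k ∈ (Finset.univ.erase i).erase j, orient key (g k) (f i) * orient key (g k) (f j) := by
    rw [← Finset.prod_mul_distrib]
    refine Finset.prod_congr rfl fun k hk => ?_
    have hkj := Finset.ne_of_mem_erase hk
    rw [hgk k hkj]
    linear_combination (-(orient key (f k) (f i) * orient key (f k) b')) *
      orient_mul_self hkey (hf.ne hkj)
  rw [e4, e1, e2, e7, e6]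
  linear_combination (-(∏ k ∈ (Finset.univ.erase i).erase j,
      orient key (f k) (f j) * orient key (f k) b') *
        ∏ k ∈ (Finset.univ.erase i).erase j, orient key (g k) (f i) * orient key (g k) (f j)) * e5

end Orientation

/-! ### Lines of the lattice and the ordering of the orbitals -/

variable {Lx Ly N : ℕ}

/-- The number of vertices on a line in a direction. -/
def len (Lx Ly : ℕ) : Dir → ℕ
  | .x => Lx
  | .y => Ly

/-- The coordinate of a vertex in a direction. -/
def along : Dir → Vertex Lx Ly → ℕ
  | .x, R => R.1.val
  | .y, R => R.2.val

/-- The coordinate of a vertex perpendicular to a direction. -/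
def trans : Dir → Vertex Lx Ly → ℕ
  | .x, R => R.2.val
  | .y, R => R.1.val

/-- The line on which a `p` orbital lies. -/
def lineOf : Site Lx Ly → Option (Dir × ℕ)
  | .d _ => none
  | .p δ R => some (δ, trans δ R)

theorem trans_sub_unit (δ : Dir) (R : Vertex Lx Ly) : trans δ (R - unit δ) = trans δ R := by
  cases δ <;> simp [trans, unit]

theorem lineOf_pBehind (δ : Dir) (R : Vertex Lx Ly) :
    lineOf (pBehind δ R) = some (δ, trans δ R) := by
  simp [pBehind, lineOf, trans_sub_unit]

theorem lineOf_pAhead (δ : Dir) (R : Vertex Lx Ly) :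
    lineOf (pAhead δ R) = some (δ, trans δ R) := rfl

theorem zmod_val_sub_one {L : ℕ} [NeZero L] (r : ZMod L) :
    (r.val = 0 ∧ (r - 1).val = L - 1) ∨ (r - 1).val + 1 = r.val := by
  obtain ⟨n, rfl⟩ := Nat.exists_eq_succ_of_ne_zero (NeZero.ne L)
  by_cases h : r = 0
  · subst h
    left
    simp [ZMod.val_neg_one]
  · right
    have h1 : (r - 1).val = r.val - 1 := Fin.val_sub_one_of_ne_zero h
    have h2 : r.val ≠ 0 := by simpa [ZMod.val_eq_zero] using h
    omega

theorem along_sub_unit [NeZero Lx] [NeZero Ly] (δ : Dir) (R : Vertex Lx Ly) :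
    (along δ R = 0 ∧ along δ (R - unit δ) = len Lx Ly δ - 1) ∨
      along δ (R - unit δ) + 1 = along δ R := by
  cases δ
  · exact zmod_val_sub_one R.1
  · exact zmod_val_sub_one R.2

theorem along_lt_len [NeZero Lx] [NeZero Ly] (δ : Dir) (R : Vertex Lx Ly) :
    along δ R < len Lx Ly δ := by
  cases δ
  · exact ZMod.val_lt R.1
  · exact ZMod.val_lt R.2

theorem vertex_ext [NeZero Lx] [NeZero Ly] {δ : Dir} {R R' : Vertex Lx Ly}
    (h1 : trans δ R = trans δ R') (h2 : along δ R = along δ R') : R = R' := by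
  cases δ
  · exact Prod.ext (ZMod.val_injective _ h2) (ZMod.val_injective _ h1)
  · exact Prod.ext (ZMod.val_injective _ h1) (ZMod.val_injective _ h2)

/-- The rank of a direction. -/
def Dir.rank : Dir → ℕ
  | .x => 1
  | .y => 2

/-- A key for the linear order on the orbitals that lists the `d` orbitals first, then the `x`-bonds
row by row, and then the `y`-bonds column by column. -/
def key : Site Lx Ly → ℕ ×ₗ ℕ ×ₗ ℕ
  | .d R => toLex (0, toLex (R.1.val, R.2.val))
  | .p δ R => toLex (δ.rank, toLex (trans δ R, along δ R))

theorem key_injective [NeZero Lx] [NeZero Ly] :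
    Function.Injective (key : Site Lx Ly → ℕ ×ₗ ℕ ×ₗ ℕ) := by
  intro a b h
  cases a with
  | d R =>
    cases b with
    | d R' =>
      simp only [key, EmbeddingLike.apply_eq_iff_eq, Prod.mk.injEq, true_and] at h
      rw [Prod.ext (ZMod.val_injective _ h.1) (ZMod.val_injective _ h.2)]
    | p δ R' => cases δ <;> simp [key, Dir.rank] at h
  | p δ R =>
    cases b with
    | d R' => cases δ <;> simp [key, Dir.rank] at h
    | p δ' R' =>
      simp only [key, EmbeddingLike.apply_eq_iff_eq, Prod.mk.injEq] at h
      have hδ : δ = δ' := by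
        cases δ <;> cases δ' <;> simp [Dir.rank] at h ⊢
      subst hδ
      rw [vertex_ext h.2.1 h.2.2]

theorem key_d_lt (R R' : Vertex Lx Ly) (δ : Dir) : key (.d R) < key (.p δ R') := by
  refine Prod.Lex.toLex_lt_toLex.mpr (Or.inl ?_)
  cases δ <;> simp [Dir.rank]

theorem key_p_lt_iff {δ δ' : Dir} {R R' : Vertex Lx Ly} :
    key (.p δ R) < key (.p δ' R') ↔
      δ.rank < δ'.rank ∨ δ = δ' ∧ (trans δ R < trans δ' R' ∨
        trans δ R = trans δ' R' ∧ along δ R < along δ' R') := by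
  have : δ.rank = δ'.rank ↔ δ = δ' := by cases δ <;> cases δ' <;> simp [Dir.rank]
  simp only [key, Prod.Lex.toLex_lt_toLex, this]

/-- Each line is an interval for `key`, so an orbital off the line lies on the same side of all its
bonds. -/
theorem orient_key_mul_of_lineOf_ne [NeZero Lx] [NeZero Ly] {a b b' : Site Lx Ly}
    {ℓ : Dir × ℕ} (hb : lineOf b = some ℓ) (hb' : lineOf b' = some ℓ) (ha : lineOf a ≠ some ℓ) :
    orient key a b * orient key a b' = 1 := by
  have hab : a ≠ b := fun h => ha (h ▸ hb)
  suffices orient key a b = orient key a b' by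
    rw [← this]
    exact orient_mul_self key_injective hab
  cases b with
  | d R => simp [lineOf] at hb
  | p δ R =>
    cases b' with
    | d R => simp [lineOf] at hb'
    | p δ' R' =>
      obtain rfl : (δ, trans δ R) = ℓ := Option.some.inj hb
      simp only [lineOf, Option.some.injEq, Prod.mk.injEq] at hb'
      obtain ⟨rfl, hR⟩ := hb'
      cases a with
      | d R'' => rw [orient_of_lt (key_d_lt _ _ _), orient_of_lt (key_d_lt _ _ _)]
      | p δ'' R'' =>
        unfold orient
        simp only [key_p_lt_iff, hR]
        by_cases hδ : δ'' = δ'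
        · subst hδ
          have : trans δ'' R'' ≠ trans δ'' R := fun h => ha (by simp [lineOf, h])
          simp [this, Ne.symm this]
        · simp [hδ, Ne.symm hδ]

theorem orient_key_of_lineOf_eq {δ : Dir} {R R' : Vertex Lx Ly} (h : trans δ R = trans δ R') :
    orient key (.p δ R : Site Lx Ly) (.p δ R') = orient (fun n : ℕ => n) (along δ R) (along δ R') := by
  unfold orient
  simp only [key_p_lt_iff, h]
  simp

theorem exists_eq_p_of_lineOf {a : Site Lx Ly} {δ : Dir} {t : ℕ} (h : lineOf a = some (δ, t)) :
    ∃ R, a = .p δ R ∧ trans δ R = t := by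
  cases a with
  | d R => simp [lineOf] at h
  | p δ' R =>
    simp only [lineOf, Option.some.injEq, Prod.mk.injEq] at h
    obtain ⟨rfl, h⟩ := h
    exact ⟨R, rfl, h⟩

/-- How an electron on `a` separates the two bonds at `R`. -/
theorem orient_key_bonds [NeZero Lx] [NeZero Ly] {δ : Dir} {R : Vertex Lx Ly} {a : Site Lx Ly}
    (h1 : a ≠ pBehind δ R) (h2 : a ≠ pAhead δ R) :
    orient key a (pBehind δ R) * orient key a (pAhead δ R)
      = if along δ R = 0 ∧ lineOf a = some (δ, trans δ R) then -1 else 1 := by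
  by_cases hl : lineOf a = some (δ, trans δ R)
  · obtain ⟨R', rfl, hR'⟩ := exists_eq_p_of_lineOf hl
    have n1 : along δ R' ≠ along δ (R - unit δ) := fun h =>
      h1 (by rw [pBehind, vertex_ext (hR'.trans (trans_sub_unit δ R).symm) h])
    have n2 : along δ R' ≠ along δ R := fun h => h2 (by rw [pAhead, vertex_ext hR' h])
    have hlt := along_lt_len δ R'
    rw [pBehind, pAhead, orient_key_of_lineOf_eq hR',
      orient_key_of_lineOf_eq (hR'.trans (trans_sub_unit δ R).symm)]
    -- Across the boundary the two bonds are the last and the first of the line, and every other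
    -- bond of it lies between them; otherwise they are consecutive and nothing does.
    rcases along_sub_unit δ R with ⟨h0, h3⟩ | h3
    · rw [if_pos ⟨h0, hl⟩, orient_of_lt (by omega), orient_of_gt (by omega)]
      norm_num
    · rw [if_neg (by omega)]
      rcases lt_or_gt_of_ne n2 with h | h
      · rw [orient_of_lt (by omega), orient_of_lt (by omega)]
        norm_num
      · rw [orient_of_gt (by omega), orient_of_gt (by omega)]
        norm_num
  · rw [if_neg (fun h => hl h.2)]
    exact orient_key_mul_of_lineOf_ne (lineOf_pBehind δ R) (lineOf_pAhead δ R) hl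

/-- The number of electrons on the bonds of a line. -/
def Config.lineCount (c : Config Lx Ly N) (ℓ : Dir × ℕ) : ℕ :=
  (Finset.univ.filter fun k => lineOf (c.pos k) = some ℓ).card

theorem Config.lineCount_eq (c : Config Lx Ly N) (ℓ : Dir × ℕ) {i j : Fin N} (hij : i ≠ j) :
    c.lineCount ℓ = (if lineOf (c.pos i) = some ℓ then 1 else 0) +
      ((if lineOf (c.pos j) = some ℓ then 1 else 0) +
      (((Finset.univ.erase i).erase j).filter fun k => lineOf (c.pos k) = some ℓ).card) := by
  rw [lineCount, Finset.card_filter, Finset.card_filter,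
    ← Finset.add_sum_erase _ _ (Finset.mem_univ i),
    ← Finset.add_sum_erase _ _ (Finset.mem_erase.mpr ⟨hij.symm, Finset.mem_univ j⟩)]

theorem Config.X_eq_lineCount [NeZero Lx] [NeZero Ly] (c : Config Lx Ly N) (y : ZMod Ly) :
    c.X y = c.lineCount (.x, y.val) := by
  simp only [X, occupation, lineCount, Finset.card_filter]
  rw [Finset.sum_comm]
  refine Finset.sum_congr rfl fun k _ => ?_
  cases c.pos k with
  | d R => simp [lineOf]
  | p δ R =>
    obtain ⟨R1, R2⟩ := R
    cases δ <;> simp [lineOf, trans, (ZMod.val_injective Ly).eq_iff, ite_and]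

theorem Config.Y_eq_lineCount [NeZero Lx] [NeZero Ly] (c : Config Lx Ly N) (x : ZMod Lx) :
    c.Y x = c.lineCount (.y, x.val) := by
  simp only [Y, occupation, lineCount, Finset.card_filter]
  rw [Finset.sum_comm]
  refine Finset.sum_congr rfl fun k _ => ?_
  cases c.pos k with
  | d R => simp [lineOf]
  | p δ R =>
    obtain ⟨R1, R2⟩ := R
    cases δ <;> simp [lineOf, trans, (ZMod.val_injective Lx).eq_iff, ite_and]

/-! ### The conserved sign -/

/-- The sign with which an occupied orbital enters the gauge. -/
def weight : Site Lx Ly → ℤ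
  | .d _ => 1
  | .p δ R => (-1) ^ along δ R

/-- A sign which is antisymmetric under permutations of the electrons. -/
def Config.gauge (c : Config Lx Ly N) : ℤ :=
  orientation key c.pos * ∏ k, weight (c.pos k)

theorem weight_mul_self (s : Site Lx Ly) : weight s * weight s = 1 := by
  cases s with
  | d R => simp [weight]
  | p δ R => simp [weight, ← mul_pow]

theorem Config.gauge_mul_self [NeZero Lx] [NeZero Ly] (c : Config Lx Ly N) :
    c.gauge * c.gauge = 1 := by
  have h : (∏ k, weight (c.pos k)) * ∏ k, weight (c.pos k) = 1 := by
    rw [← Finset.prod_mul_distrib]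
    exact Finset.prod_eq_one fun k _ => weight_mul_self _
  rw [gauge, mul_mul_mul_comm, orientation_mul_self key_injective c.injective, h, one_mul]

theorem Config.gauge_permute (c : Config Lx Ly N) (π : Equiv.Perm (Fin N)) :
    (c.permute π).gauge = Equiv.Perm.sign π * c.gauge := by
  have h1 : orientation key (c.permute π).pos = Equiv.Perm.sign π * orientation key c.pos :=
    orientation_comp_perm key c.pos π
  have h2 : ∏ k, weight ((c.permute π).pos k) = ∏ k, weight (c.pos k) :=
    Equiv.prod_comp π fun k => weight (c.pos k)
  rw [gauge, h1, h2, gauge, mul_assoc]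

theorem ForwardHop.lineCount_eq {R : Vertex Lx Ly} {δ : Dir} {σ σ' : Spin} {s : Fin N → Spin}
    {c c' : Config Lx Ly N} (h : ForwardHop R δ σ σ' s c c') (ℓ : Dir × ℕ) :
    c'.lineCount ℓ = c.lineCount ℓ := by
  obtain ⟨i, j, hi, -, hj, -, -, hi', hj', hk⟩ := h
  have hij : i ≠ j := by
    rintro rfl
    rw [hi] at hj
    cases hj
  rw [c.lineCount_eq ℓ hij, c'.lineCount_eq ℓ hij, hi, hj, hi', hj', lineOf_pBehind, lineOf_pAhead]
  have : (((Finset.univ.erase i).erase j).filter fun k => lineOf (c'.pos k) = some ℓ)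
      = ((Finset.univ.erase i).erase j).filter fun k => lineOf (c.pos k) = some ℓ := by
    refine Finset.filter_congr fun k hmem => ?_
    have h1 := Finset.ne_of_mem_erase hmem
    have h2 := Finset.ne_of_mem_erase (Finset.mem_of_mem_erase hmem)
    rw [hk k h2 h1]
  rw [this]
  simp only [lineOf]
  simp

/-- Both factors of the gauge change by computable signs: `orientation_push` with `orient_key_bonds`
gives the ordering, and the two bond positions give the weights. The parity hypothesis is what makes
them cancel at the boundary. -/
theorem ForwardHop.gauge_eq [NeZero Lx] [NeZero Ly] {R : Vertex Lx Ly} {δ : Dir} {σ σ' : Spin}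
    {s : Fin N → Spin} {c c' : Config Lx Ly N} (h : ForwardHop R δ σ σ' s c c')
    (hodd : Odd (len Lx Ly δ + c.lineCount (δ, trans δ R))) : c'.gauge = c.gauge := by
  obtain ⟨i, j, hi, -, hj, -, hfree, hi', hj', hk⟩ := h
  have hij : i ≠ j := by
    rintro rfl
    rw [hi] at hj
    cases hj
  have ho := orientation_push (key := key) key_injective c.injective hij hfree (hi'.trans hj.symm)
    hj' hk (by rw [hi, hj]; exact key_d_lt _ _ _) (by rw [hj]; exact key_d_lt _ _ _)
  have hcount := c.lineCount_eq (δ, trans δ R) hij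
  set S := ((Finset.univ.erase i).erase j : Finset (Fin N)) with hS
  have hSi : ∀ k ∈ S, k ≠ i := fun k hmem => Finset.ne_of_mem_erase (Finset.mem_of_mem_erase hmem)
  have hSj : ∀ k ∈ S, k ≠ j := fun k hmem => Finset.ne_of_mem_erase hmem
  have hw : (∏ k, weight (c.pos k)) * ∏ k, weight (c'.pos k)
      = (-1) ^ (along δ (R - unit δ) + along δ R) := by
    rw [← Finset.prod_mul_distrib, ← Finset.mul_prod_erase _ _ (Finset.mem_univ i),
      ← Finset.mul_prod_erase _ _ (Finset.mem_erase.mpr ⟨hij.symm, Finset.mem_univ j⟩),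
      Finset.prod_eq_one (fun k hmem => by rw [hk k (hSi k hmem) (hSj k hmem), weight_mul_self]),
      hi, hj, hi', hj', pBehind, pAhead]
    simp [weight, pow_add]
  have hp : ∏ k ∈ S, orient key (c.pos k) (c.pos i) * orient key (c.pos k) (pAhead δ R)
      = ∏ k ∈ S, if along δ R = 0 ∧ lineOf (c.pos k) = some (δ, trans δ R) then (-1 : ℤ) else 1 := by
    refine Finset.prod_congr rfl fun k hmem => ?_
    rw [hi]
    exact orient_key_bonds (fun hcon => hSi k hmem (c.injective (hcon.trans hi.symm))) (hfree k)
  rw [hp] at ho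
  rw [hi, hj, lineOf_pBehind] at hcount
  rw [if_pos rfl, if_neg (show lineOf (Site.d R) ≠ some (δ, trans δ R) from nofun), zero_add] at hcount
  have hgg : c.gauge * c'.gauge = 1 := by
    rw [Config.gauge, Config.gauge, mul_mul_mul_comm, ho, hw]
    rcases along_sub_unit δ R with ⟨h0, h1⟩ | h1
    · simp only [h0, true_and]
      rw [← Finset.prod_filter, Finset.prod_const, h1, neg_mul, ← pow_add, neg_eq_iff_eq_neg]
      refine Odd.neg_one_pow ?_
      have := along_lt_len δ R
      rw [hcount] at hodd
      rw [Nat.odd_iff] at hodd ⊢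
      omega
    · rw [Finset.prod_eq_one (fun k _ => if_neg (by omega)), ← h1]
      have : along δ (R - unit δ) + (along δ (R - unit δ) + 1)
        = 2 * along δ (R - unit δ) + 1 := by ring
      rw [this, pow_succ, pow_mul]
      simp
  linear_combination (-c'.gauge) * c.gauge_mul_self + c.gauge * hgg

/-- The occupation numbers of all lines and the gauge are conserved. -/
theorem Connected.conserved [NeZero Lx] [NeZero Ly] {s : Fin N → Spin} {c c' : Config Lx Ly N}
    (h : Connected s c c') : (∀ ℓ, c'.lineCount ℓ = c.lineCount ℓ) ∧
      ((∀ (δ : Dir) (R : Vertex Lx Ly), Odd (len Lx Ly δ + c.lineCount (δ, trans δ R))) →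
        c'.gauge = c.gauge) := by
  -- The two invariants go together: the parity condition passes to each intermediate configuration
  -- through its line counts.
  induction h with
  | refl => exact ⟨fun _ => rfl, fun _ => rfl⟩
  | @tail b b' _ hstep ih =>
    obtain ⟨h, hm⟩ := hstep
    unfold HoppingTerm.Maps at hm
    split_ifs at hm
    · have hb : ∀ ℓ, b'.lineCount ℓ = c.lineCount ℓ := fun ℓ => (hm.lineCount_eq ℓ).symm.trans (ih.1 ℓ)
      exact ⟨hb, fun hodd => (hm.gauge_eq (by rw [hb]; exact hodd _ _)).symm.trans (ih.2 hodd)⟩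
    · exact ⟨fun ℓ => (hm.lineCount_eq ℓ).trans (ih.1 ℓ),
        fun hodd => (hm.gauge_eq (by rw [ih.1]; exact hodd _ _)).trans (ih.2 hodd)⟩

theorem sign_eq_one_of_connected [NeZero Lx] [NeZero Ly] {s : Fin N → Spin} {c : Config Lx Ly N}
    (hodd : ∀ (δ : Dir) (R : Vertex Lx Ly), Odd (len Lx Ly δ + c.lineCount (δ, trans δ R)))
    {π : Equiv.Perm (Fin N)} (h : Connected s c (c.permute π)) : Equiv.Perm.sign π = 1 := by
  have h1 := h.conserved.2 hodd
  rw [c.gauge_permute] at h1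
  have h2 : ((Equiv.Perm.sign π : ℤˣ) : ℤ) = 1 := by
    linear_combination c.gauge * h1 - (((Equiv.Perm.sign π : ℤˣ) : ℤ) - 1) * c.gauge_mul_self
  exact Units.ext h2

/-! ### The group of induced permutations -/

section Connectivity

variable {s : Fin N → Spin} {c c' c'' : Config Lx Ly N}

theorem Connected.trans (h : Connected s c c') (h' : Connected s c' c'') : Connected s c c'' :=
  Relation.ReflTransGen.trans h h'

theorem Connected.symm (h : Connected s c c') : Connected s c' c := by
  refine (@Relation.ReflTransGen.stdSymm _ _ ⟨?_⟩).symm _ _ h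
  rintro b b' ⟨⟨R, δ, σ, σ', t⟩, hm⟩
  refine ⟨⟨R, δ, σ, σ', !t⟩, ?_⟩
  cases t <;> simpa [HoppingTerm.Maps] using hm

/-- The spins of the term are existential because relabelling may put electrons of other spins on
the same orbitals; all spin pairs occur in the Hamiltonian. -/
theorem ForwardHop.permute {R : Vertex Lx Ly} {δ : Dir} {σ σ' : Spin}
    (h : ForwardHop R δ σ σ' s c c') (π : Equiv.Perm (Fin N)) :
    ∃ σ₁ σ₁', ForwardHop R δ σ₁ σ₁' s (c.permute π) (c'.permute π) := by
  obtain ⟨i, j, hi, -, hj, -, hfree, hi', hj', hk⟩ := h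
  refine ⟨_, _, π.symm i, π.symm j, ?_, rfl, ?_, rfl, fun k => hfree _, ?_, ?_, fun k h1 h2 => ?_⟩
  · simpa [Config.permute] using hi
  · simpa [Config.permute] using hj
  · simpa [Config.permute] using hi'
  · simpa [Config.permute] using hj'
  · exact hk _ (fun h => h1 (by simp [← h])) (fun h => h2 (by simp [← h]))

theorem Connected.permute (h : Connected s c c') (π : Equiv.Perm (Fin N)) :
    Connected s (c.permute π) (c'.permute π) := by
  refine Relation.ReflTransGen.lift (fun b : Config Lx Ly N => b.permute π) ?_ _ _ h
  rintro b b' ⟨⟨R, δ, σ, σ', t⟩, hm⟩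
  cases t
  · obtain ⟨σ₁, σ₁', h'⟩ := ForwardHop.permute (s := s) (c := b) (c' := b') hm π
    exact ⟨⟨R, δ, σ₁, σ₁', false⟩, h'⟩
  · obtain ⟨σ₁, σ₁', h'⟩ := ForwardHop.permute (s := s) (c := b') (c' := b) hm π
    exact ⟨⟨R, δ, σ₁, σ₁', true⟩, h'⟩

/-- The group of the permutations which the dynamics induces from a configuration. -/
def inducedGroup (s : Fin N → Spin) (c : Config Lx Ly N) : Subgroup (Equiv.Perm (Fin N)) where
  carrier := {π | Connected s c (c.permute π)}
  one_mem' := Relation.ReflTransGen.refl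
  mul_mem' {π ρ} hπ hρ := Connected.trans hρ (Connected.permute hπ ρ)
  inv_mem' {π} hπ := by
    have h := (Connected.permute hπ π⁻¹).symm
    have h1 : (c.permute π).permute π⁻¹ = c := by
      ext k
      simp [Config.permute]
    rwa [h1] at h

theorem mem_inducedGroup {π : Equiv.Perm (Fin N)} :
    π ∈ inducedGroup s c ↔ Connected s c (c.permute π) := Iff.rfl

/-- Permutations act on labels and commute with the dynamics, so a path to `c'` and its relabelled
reverse transfer them without conjugation. Three-cycles may therefore be sought in any reachable
configuration. -/
theorem Connected.inducedGroup_le (h : Connected s c c') : inducedGroup s c' ≤ inducedGroup s c :=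
  fun π hπ => (h.trans hπ).trans (h.permute π).symm

theorem Linked.mono {G H : Subgroup (Equiv.Perm (Fin N))} (hGH : G ≤ H) {a b : Fin N}
    (h : Linked G a b) : Linked H a b := by
  obtain ⟨g, hg, h3⟩ := h
  exact ⟨g, hGH hg, h3⟩

end Connectivity

/-! ### Hops in oriented directions and transport along lines -/

section OrientedBonds

/-- The lattice vector of an oriented direction. -/
def step (v : Dir × Bool) : Vertex Lx Ly := if v.2 then unit v.1 else -unit v.1

/-- The bond that leaves a vertex in an oriented direction. -/
def bond (R : Vertex Lx Ly) (v : Dir × Bool) : Site Lx Ly :=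
  .p v.1 (if v.2 then R else R - unit v.1)

/-- The opposite oriented direction. -/
def opp (v : Dir × Bool) : Dir × Bool := (v.1, !v.2)

@[simp]
theorem opp_opp (v : Dir × Bool) : opp (opp v) = v := by simp [opp]

theorem bond_add_step (R : Vertex Lx Ly) (v : Dir × Bool) :
    bond (R + step v) (opp v) = bond R v := by
  obtain ⟨δ, b⟩ := v
  cases b <;> simp [bond, step, opp, sub_eq_add_neg]

theorem bond_sub_step (R : Vertex Lx Ly) (v : Dir × Bool) :
    bond (R - step v) v = bond R (opp v) := by
  rw [← bond_add_step, sub_add_cancel]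

theorem bond_injective (v : Dir × Bool) : Function.Injective fun R : Vertex Lx Ly => bond R v := by
  obtain ⟨δ, b⟩ := v
  intro R R' h
  cases b <;> simpa [bond] using h

theorem bond_ne_d (R R' : Vertex Lx Ly) (v : Dir × Bool) : bond R v ≠ .d R' := nofun

theorem bond_ne_bond {v w : Dir × Bool} (h : v.1 ≠ w.1) (R R' : Vertex Lx Ly) :
    bond R v ≠ bond R' w := fun he => h (Site.p.inj he).1

end OrientedBonds

section Hops

variable (s : Fin N → Spin) (c : Config Lx Ly N)

theorem exists_hop (R : Vertex Lx Ly) (v : Dir × Bool) {i j : Fin N}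
    (hi : c.pos i = bond R (opp v)) (hj : c.pos j = .d R) (hfree : ∀ k, c.pos k ≠ bond R v) :
    ∃ c' : Config Lx Ly N, Connected s c c' ∧ c'.pos i = .d R ∧ c'.pos j = bond R v ∧
      ∀ k, k ≠ i → k ≠ j → c'.pos k = c.pos k := by
  have hne : bond R (opp v) ≠ bond R v := hi ▸ hfree i
  -- The hop is a three-cycle of orbitals, with the vacancy going to the bond behind; injectivity of
  -- the new configuration is then automatic.
  let g : Equiv.Perm (Site Lx Ly) :=
    Equiv.swap (bond R (opp v)) (.d R) * Equiv.swap (.d R) (bond R v)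
  have g1 : g (bond R (opp v)) = .d R := by
    simp only [g, Equiv.Perm.mul_apply]
    rw [Equiv.swap_apply_of_ne_of_ne (bond_ne_d _ _ _) hne, Equiv.swap_apply_left]
  have g2 : g (.d R) = bond R v := by
    simp only [g, Equiv.Perm.mul_apply]
    rw [Equiv.swap_apply_left, Equiv.swap_apply_of_ne_of_ne hne.symm (bond_ne_d _ _ _)]
  have g3 : ∀ t, t ≠ bond R (opp v) → t ≠ .d R → t ≠ bond R v → g t = t := by
    intro t h1 h2 h3
    simp only [g, Equiv.Perm.mul_apply]
    rw [Equiv.swap_apply_of_ne_of_ne h2 h3, Equiv.swap_apply_of_ne_of_ne h1 h2]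
  have hk : ∀ k, k ≠ i → k ≠ j → g (c.pos k) = c.pos k := fun k h1 h2 =>
    g3 _ (fun h => h1 (c.injective (h.trans hi.symm)))
      (fun h => h2 (c.injective (h.trans hj.symm))) (hfree k)
  have hi' : g (c.pos i) = .d R := by rw [hi, g1]
  have hj' : g (c.pos j) = bond R v := by rw [hj, g2]
  let c' : Config Lx Ly N :=
    { pos := fun k => g (c.pos k)
      injective := g.injective.comp c.injective
      d_filled := fun R' => by
        by_cases h : R' = R
        · exact ⟨i, by rw [hi', h]⟩
        · obtain ⟨k, hk⟩ := c.d_filled R'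
          exact ⟨k, by
            rw [hk]
            exact g3 _ (bond_ne_d _ _ _).symm (fun he => h (Site.d.inj he)) (bond_ne_d _ _ _).symm⟩ }
  refine ⟨c', Relation.ReflTransGen.single ?_, hi', hj', hk⟩
  obtain ⟨δ, b⟩ := v
  cases b
  · refine ⟨⟨R, δ, s j, s i, true⟩, j, i, hj', rfl, hi', rfl, fun k h => ?_, hj, hi,
      fun k h1 h2 => (hk k h2 h1).symm⟩
    by_cases h1 : k = i
    · subst h1
      cases hi'.symm.trans h
    by_cases h2 : k = j
    · subst h2
      exact hne (h.symm.trans hj')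
    · exact h1 (c.injective ((hk k h1 h2).symm.trans (h.trans hi.symm)))
  · exact ⟨⟨R, δ, s i, s j, false⟩, i, j, hi, rfl, hj, rfl, hfree, hi', hj', hk⟩

/-- An orbital is occupied. -/
def Config.Occ (t : Site Lx Ly) : Prop := ∃ k, c.pos k = t

/-- Two configurations agree on the orbitals outside of a set. -/
def AgreeOff (S : Set (Site Lx Ly)) (c c' : Config Lx Ly N) : Prop :=
  ∀ t, t ∉ S → ∀ k, c'.pos k = t ↔ c.pos k = t

variable {s c}

theorem AgreeOff.mono {S S' : Set (Site Lx Ly)} {c' : Config Lx Ly N} (h : AgreeOff S c c')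
    (hS : S ⊆ S') : AgreeOff S' c c' := fun t ht => h t fun h' => ht (hS h')

theorem AgreeOff.trans {S : Set (Site Lx Ly)} {c' c'' : Config Lx Ly N} (h : AgreeOff S c c')
    (h' : AgreeOff S c' c'') : AgreeOff S c c'' := fun t ht k => (h' t ht k).trans (h t ht k)

theorem AgreeOff.occ_iff {S : Set (Site Lx Ly)} {c' : Config Lx Ly N} (h : AgreeOff S c c')
    {t : Site Lx Ly} (ht : t ∉ S) : c'.Occ t ↔ c.Occ t := exists_congr (h t ht)

variable (s c)

theorem exists_hop_of_occ (R : Vertex Lx Ly) (v : Dir × Bool) (hb : c.Occ (bond R (opp v)))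
    (hfree : ¬ c.Occ (bond R v)) :
    ∃ c' : Config Lx Ly N, Connected s c c' ∧
      AgreeOff {bond R v, bond R (opp v), .d R} c c' ∧
      c'.Occ (bond R v) ∧ ¬ c'.Occ (bond R (opp v)) := by
  obtain ⟨i, hi⟩ := hb
  obtain ⟨j, hj⟩ := c.d_filled R
  obtain ⟨c', hc, hi', hj', hk⟩ := exists_hop s c R v hi hj fun k hk => hfree ⟨k, hk⟩
  refine ⟨c', hc, fun t ht k => ?_, ⟨j, hj'⟩, ?_⟩
  · simp only [Set.mem_insert_iff, Set.mem_singleton_iff, not_or] at ht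
    by_cases h1 : k = i
    · subst h1
      rw [hi, hi']
      exact ⟨fun h => absurd h.symm ht.2.2, fun h => absurd h.symm ht.2.1⟩
    by_cases h2 : k = j
    · subst h2
      rw [hj, hj']
      exact ⟨fun h => absurd h.symm ht.1, fun h => absurd h.symm ht.2.2⟩
    rw [hk k h1 h2]
  · rintro ⟨k, h⟩
    by_cases h1 : k = i
    · subst h1
      rw [hi'] at h
      cases h
    by_cases h2 : k = j
    · subst h2
      exact hfree ⟨i, hi.trans (h.symm.trans hj')⟩
    · rw [hk k h1 h2] at h
      exact h1 (c.injective (h.trans hi.symm))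

theorem exists_hop_of_occ_ne (R : Vertex Lx Ly) (v : Dir × Bool)
    (h : ¬ (c.Occ (bond R v) ↔ c.Occ (bond R (opp v)))) :
    ∃ c' : Config Lx Ly N, Connected s c c' ∧
      AgreeOff {bond R v, bond R (opp v), .d R} c c' ∧
      (c'.Occ (bond R v) ↔ c.Occ (bond R (opp v))) := by
  by_cases hv : c.Occ (bond R v)
  · have ho : ¬ c.Occ (bond R (opp v)) := fun ho => h (iff_of_true hv ho)
    obtain ⟨c', h1, h2, -, h4⟩ := exists_hop_of_occ s c R (opp v) (by rwa [opp_opp]) ho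
    rw [opp_opp] at h2 h4
    exact ⟨c', h1, h2.mono (by rw [Set.insert_comm]), iff_of_false h4 ho⟩
  · have ho : c.Occ (bond R (opp v)) := by
      by_contra ho
      exact h (iff_of_false hv ho)
    obtain ⟨c', h1, h2, h3, -⟩ := exists_hop_of_occ s c R v ho hv
    exact ⟨c', h1, h2, iff_of_true h3 ho⟩

/-- The first `n + 1` bonds that one meets from `R` in the direction `v`, and the vertices between
them. -/
def segment (R : Vertex Lx Ly) (v : Dir × Bool) (n : ℕ) : Set (Site Lx Ly) :=
  {t | (∃ m ≤ n, t = bond (R + m • step v) v) ∨ ∃ m, 1 ≤ m ∧ m ≤ n ∧ t = .d (R + m • step v)}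

theorem segment_add_step_subset (R : Vertex Lx Ly) (v : Dir × Bool) (n : ℕ) :
    segment (R + step v) v n ⊆ segment R v (n + 1) := by
  have e : ∀ m : ℕ, R + step v + m • step v = R + (m + 1) • step v := fun m => by
    rw [succ_nsmul', add_assoc]
  rintro t (⟨m, hm, rfl⟩ | ⟨m, h1, hm, rfl⟩)
  · exact Or.inl ⟨m + 1, by omega, by rw [e]⟩
  · exact Or.inr ⟨m + 1, by omega, by omega, by rw [e]⟩

/-- The state of a bond can be carried along its line. -/
theorem exists_transport (v : Dir × Bool) (o : Prop) (n : ℕ) : ∀ R : Vertex Lx Ly,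
    (c.Occ (bond (R + n • step v) v) ↔ o) →
    ∃ c' : Config Lx Ly N, Connected s c c' ∧ AgreeOff (segment R v n) c c' ∧
      (c'.Occ (bond R v) ↔ o) := by
  induction n with
  | zero =>
    intro R h
    exact ⟨c, Relation.ReflTransGen.refl, fun _ _ _ => Iff.rfl, by simpa using h⟩
  | succ n ih =>
    intro R h
    rw [succ_nsmul', ← add_assoc] at h
    obtain ⟨c₁, h1, h2, h3⟩ := ih _ h
    have h2' := h2.mono (segment_add_step_subset R v n)
    -- If the bond at `R` has the wrong state, the two bonds at `R + step v` differ and a hop there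
    -- exchanges their states.
    by_cases hR : c₁.Occ (bond R v) ↔ o
    · exact ⟨c₁, h1, h2', hR⟩
    · obtain ⟨c₂, h4, h5, h6⟩ := exists_hop_of_occ_ne s c₁ (R + step v) (opp v) (by
        rw [opp_opp, bond_add_step, h3]
        exact hR)
      rw [opp_opp, bond_add_step] at h5 h6
      refine ⟨c₂, h1.trans h4, h2'.trans (h5.mono ?_), h6.trans h3⟩
      rintro t (rfl | rfl | rfl)
      · exact Or.inl ⟨0, by omega, by simp⟩
      · exact Or.inl ⟨1, by omega, by simp⟩
      · exact Or.inr ⟨1, by omega, by omega, by simp⟩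

/-- Both states occur among the bonds of each line. -/
def Mixed (c : Config Lx Ly N) : Prop :=
  ∀ (R : Vertex Lx Ly) (v : Dir × Bool) (o : Prop), ∃ n : ℕ, c.Occ (bond (R + n • step v) v) ↔ o

/-- The orbitals on the line through `R` in the direction `v`, without the last bond before `R` and
its ends. -/
def beyond (R : Vertex Lx Ly) (v : Dir × Bool) : Set (Site Lx Ly) :=
  {t | (t ≠ bond R (opp v) ∧ ∃ R', t = .p v.1 R') ∨
    ∃ R', R' ≠ R ∧ R' ≠ R - step v ∧ t = .d R'}

variable {c}

/-- Transport from the nearest bond in state `o`. The bond behind `R` is not in that state, so the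
search stops before going around the line, and neither that bond nor its end vertices are touched.
-/
theorem Mixed.exists_transport (hc : Mixed c) (R : Vertex Lx Ly) (v : Dir × Bool) (o : Prop)
    (h : ¬ (c.Occ (bond R (opp v)) ↔ o)) :
    ∃ c' : Config Lx Ly N, Connected s c c' ∧ AgreeOff (beyond R v) c c' ∧
      (c'.Occ (bond R v) ↔ o) := by
  classical
  have hex := hc R v o
  set n := Nat.find hex with hn
  have hspec : c.Occ (bond (R + n • step v) v) ↔ o := Nat.find_spec hex
  have hmin : ∀ m < n, ¬ (c.Occ (bond (R + m • step v) v) ↔ o) := fun m hm => Nat.find_min hex hm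
  -- A return to the start within `n + 1` steps would make the chosen bond the one behind `R`, or
  -- yield a nearer bond in state `o`.
  have hlast : ∀ m ≤ n, (m + 1) • (step v : Vertex Lx Ly) ≠ 0 := by
    intro m hm h0
    rcases hm.eq_or_lt with hmn | hlt
    · have : R + n • step v = R - step v := by
        rw [sub_eq_add_neg, add_right_inj, eq_neg_iff_add_eq_zero, ← succ_nsmul, ← hmn, h0]
      rw [this, bond_sub_step] at hspec
      exact h hspec
    · refine hmin (n - (m + 1)) (by omega) ?_
      have : n • (step v : Vertex Lx Ly) = (n - (m + 1)) • step v := by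
        conv_lhs => rw [← Nat.sub_add_cancel (show m + 1 ≤ n by omega), add_nsmul, h0, add_zero]
      rwa [← this]
  have hsub : ∀ m ≤ n, R + m • step v ≠ R - step v := by
    intro m hm he
    rw [sub_eq_add_neg, add_right_inj, eq_neg_iff_add_eq_zero, ← succ_nsmul] at he
    exact hlast m hm he
  obtain ⟨c', h1, h2, h3⟩ := LiebLattice.exists_transport s c v o n R hspec
  refine ⟨c', h1, h2.mono ?_, h3⟩
  rintro t (⟨m, hm, rfl⟩ | ⟨m, h1, hm, rfl⟩)
  · refine Or.inl ⟨fun he => hsub m hm ?_, _, rfl⟩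
    rw [← bond_sub_step] at he
    exact bond_injective v he
  · refine Or.inr ⟨_, fun he => ?_, hsub m hm, rfl⟩
    obtain ⟨l, rfl⟩ := Nat.exists_eq_add_of_le' h1
    exact hlast l (by omega) (by simpa using he)

end Hops

variable {s : Fin N → Spin} {c : Config Lx Ly N}

/-! ### Linking electrons by three-cycles -/

/-- At a vertex where a hop is possible in both directions, the commutator of the two hops is a
three-cycle of the electrons involved. -/
theorem exists_isThreeCycle (s : Fin N → Spin) (c : Config Lx Ly N) (R : Vertex Lx Ly)
    {v w : Dir × Bool} (hvw : v.1 ≠ w.1) {a b e : Fin N}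
    (ha : c.pos a = bond R v) (hb : c.pos b = bond R w) (he : c.pos e = .d R)
    (hv : ¬ c.Occ (bond R (opp v))) (hw : ¬ c.Occ (bond R (opp w))) :
    Linked (inducedGroup s c) a e := by
  have hae : a ≠ e := fun h => bond_ne_d R R v (by rw [← ha, h, he])
  have hbe : b ≠ e := fun h => bond_ne_d R R w (by rw [← hb, h, he])
  have hab : a ≠ b := fun h => bond_ne_bond hvw R R (by rw [← ha, h, hb])
  have hv' : bond R v ≠ bond R (opp v) := fun h => hv ⟨a, ha.trans h⟩
  have hw' : bond R w ≠ bond R (opp w) := fun h => hw ⟨b, hb.trans h⟩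
  have d1 : bond R (opp v) ≠ bond R (opp w) := bond_ne_bond (by exact hvw) R R
  have d2 : bond R (opp v) ≠ bond R w := bond_ne_bond (by exact hvw) R R
  have d3 : bond R v ≠ bond R (opp w) := bond_ne_bond (by exact hvw) R R
  have d4 : bond R v ≠ bond R w := bond_ne_bond hvw R R
  -- The four hops go along `v`, along `w`, back along `v`, back along `w`; the electrons visiting
  -- the vertex are in turn `a`, `b`, `e`, `a`.
  obtain ⟨c₁, h1, a1, e1, k1⟩ := exists_hop s c R (opp v) (i := a) (j := e) (by rwa [opp_opp]) he
    fun k hk => hv ⟨k, hk⟩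
  have b1 : c₁.pos b = bond R w := (k1 b hab.symm hbe).trans hb
  have f1 : ∀ k, c₁.pos k ≠ bond R (opp w) := by
    intro k hk
    by_cases hka : k = a
    · subst hka
      exact (bond_ne_d _ _ _).symm (a1.symm.trans hk)
    by_cases hke : k = e
    · subst hke
      exact d1 (e1.symm.trans hk)
    exact hw ⟨k, (k1 k hka hke).symm.trans hk⟩
  obtain ⟨c₂, h2, b2, a2, k2⟩ := exists_hop s c₁ R (opp w) (i := b) (j := a) (by rwa [opp_opp]) a1 f1
  have e2 : c₂.pos e = bond R (opp v) := (k2 e hbe.symm hae.symm).trans e1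
  have o2 : ∀ k, k ≠ a → k ≠ b → k ≠ e → c₂.pos k = c.pos k := fun k hka hkb hke =>
    (k2 k hkb hka).trans (k1 k hka hke)
  have f2 : ∀ k, c₂.pos k ≠ bond R v := by
    intro k hk
    by_cases hka : k = a
    · subst hka
      exact d3 (hk.symm.trans a2)
    by_cases hkb : k = b
    · subst hkb
      exact bond_ne_d _ _ _ (hk.symm.trans b2)
    by_cases hke : k = e
    · subst hke
      exact hv' (hk.symm.trans e2)
    exact hka (c.injective ((o2 k hka hkb hke).symm.trans (hk.trans ha.symm)))
  obtain ⟨c₃, h3, e3, b3, k3⟩ := exists_hop s c₂ R v (i := e) (j := b) e2 b2 f2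
  have a3 : c₃.pos a = bond R (opp w) := (k3 a hae hab).trans a2
  have f3 : ∀ k, c₃.pos k ≠ bond R w := by
    intro k hk
    by_cases hka : k = a
    · subst hka
      exact hw' (hk.symm.trans a3)
    by_cases hkb : k = b
    · subst hkb
      exact d4 (b3.symm.trans hk)
    by_cases hke : k = e
    · subst hke
      exact bond_ne_d _ _ _ (hk.symm.trans e3)
    exact hkb (c.injective ((o2 k hka hkb hke).symm.trans
      ((k3 k hke hkb).symm.trans (hk.trans hb.symm))))
  obtain ⟨c₄, h4, a4, e4, k4⟩ := exists_hop s c₃ R w (i := a) (j := e) a3 e3 f3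
  have b4 : c₄.pos b = bond R v := (k4 b hab.symm hbe).trans b3
  set π := Equiv.swap e a * Equiv.swap e b with hπ
  have πa : π a = e := by
    simp [hπ, Equiv.swap_apply_of_ne_of_ne hae hab]
  have πe : π e = b := by
    simp [hπ, Equiv.swap_apply_of_ne_of_ne hbe hab.symm]
  have πb : π b = a := by simp [hπ]
  have hc₄ : c₄ = c.permute π := by
    ext k
    change c₄.pos k = c.pos (π k)
    by_cases hka : k = a
    · subst hka
      rw [πa, a4, he]
    by_cases hkb : k = b
    · subst hkb
      rw [πb, b4, ha]
    by_cases hke : k = e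
    · subst hke
      rw [πe, e4, hb]
    have πk : π k = k := by
      simp [hπ, Equiv.swap_apply_of_ne_of_ne hke hkb, Equiv.swap_apply_of_ne_of_ne hke hka]
    rw [πk, k4 k hka hke, k3 k hke hkb, o2 k hka hkb hke]
  refine ⟨π, ?_, Equiv.Perm.isThreeCycle_swap_mul_swap_same hae.symm hbe.symm hab, ?_, ?_⟩
  · rw [mem_inducedGroup, ← hc₄]
    exact ((h1.trans h2).trans h3).trans h4
  · rw [πa]
    exact hae.symm
  · rw [πe]
    exact hbe

/-- The other bond direction. -/
def Dir.perp : Dir → Dir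
  | .x => .y
  | .y => .x

theorem Dir.ne_perp (δ : Dir) : δ ≠ δ.perp := by cases δ <;> simp [Dir.perp]

theorem bond_notMem_beyond {v w : Dir × Bool} (h : w.1 ≠ v.1) (R R' : Vertex Lx Ly) :
    bond R' w ∉ beyond R v := by
  rintro (⟨-, R'', he⟩ | ⟨R'', -, -, he⟩)
  · exact h (Site.p.inj he).1
  · exact bond_ne_d _ _ _ he

theorem bond_opp_notMem_beyond (R : Vertex Lx Ly) (v : Dir × Bool) :
    bond R (opp v) ∉ beyond R v := by
  rintro (⟨h, -⟩ | ⟨R'', -, -, he⟩)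
  · exact h rfl
  · exact bond_ne_d _ _ _ he

theorem d_notMem_beyond (R : Vertex Lx Ly) (v : Dir × Bool) : .d R ∉ beyond R v := by
  rintro (⟨-, R'', he⟩ | ⟨R'', h, -, he⟩)
  · cases he
  · exact h (Site.d.inj he).symm

theorem d_sub_step_notMem_beyond (R : Vertex Lx Ly) (v : Dir × Bool) :
    .d (R - step v) ∉ beyond R v := by
  rintro (⟨-, R'', he⟩ | ⟨R'', -, h, he⟩)
  · cases he
  · exact h (Site.d.inj he).symm

/-- A hop along `v` is already possible. Transport on the perpendicular line makes its two bonds at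
`R` differ, which allows a hop there too and leaves `R` and the bonds along `v` alone. -/
theorem linked_of_free (hc : Mixed c) (R : Vertex Lx Ly) (v : Dir × Bool) {a e : Fin N}
    (ha : c.pos a = bond R v) (he : c.pos e = .d R) (hv : ¬ c.Occ (bond R (opp v))) :
    Linked (inducedGroup s c) a e := by
  have key : ∀ (w : Dir × Bool) (c' : Config Lx Ly N), v.1 ≠ w.1 → c'.pos a = bond R v →
      c'.pos e = .d R → ¬ c'.Occ (bond R (opp v)) →
      ¬ (c'.Occ (bond R w) ↔ c'.Occ (bond R (opp w))) → Linked (inducedGroup s c') a e := by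
    intro w c' hvw ha he hv hw
    by_cases h : c'.Occ (bond R w)
    · have h' : ¬ c'.Occ (bond R (opp w)) := fun h' => hw (iff_of_true h h')
      obtain ⟨b, hb⟩ := h
      exact exists_isThreeCycle s c' R hvw ha hb he hv h'
    · have h' : c'.Occ (bond R (opp w)) := by
        by_contra h'
        exact hw (iff_of_false h h')
      obtain ⟨b, hb⟩ := h'
      exact exists_isThreeCycle s c' R (w := opp w) hvw ha hb he hv (by rwa [opp_opp])
  let w : Dir × Bool := (v.1.perp, true)
  have hvw : v.1 ≠ w.1 := v.1.ne_perp
  obtain ⟨c', h1, h2, h3⟩ := hc.exists_transport (s := s) R w (¬ c.Occ (bond R (opp w)))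
    (by tauto)
  refine (key w c' hvw ?_ ?_ ?_ ?_).mono h1.inducedGroup_le
  · rwa [h2 _ (bond_notMem_beyond hvw _ _)]
  · rwa [h2 _ (d_notMem_beyond _ _)]
  · rwa [h2.occ_iff (bond_notMem_beyond (show (opp v).1 ≠ w.1 from hvw) _ _)]
  · rw [h2.occ_iff (bond_opp_notMem_beyond _ _), h3]
    tauto

/-- All configurations that can be reached are mixed. -/
def Robust (s : Fin N → Spin) (c : Config Lx Ly N) : Prop := ∀ c', Connected s c c' → Mixed c'

theorem Robust.of_connected {c' : Config Lx Ly N} (hc : Robust s c) (h : Connected s c c') :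
    Robust s c' := fun c'' h' => hc c'' (h.trans h')

theorem Robust.mixed (hc : Robust s c) : Mixed c := hc c Relation.ReflTransGen.refl

/-- If the opposite bond is occupied, a vacancy is first brought to it from the far side, leaving
`a` and `e` in place. -/
theorem linked_bond (hc : Robust s c) (R : Vertex Lx Ly) (v : Dir × Bool) {a e : Fin N}
    (ha : c.pos a = bond R v) (he : c.pos e = .d R) : Linked (inducedGroup s c) a e := by
  by_cases hv : c.Occ (bond R (opp v))
  · obtain ⟨c', h1, h2, h3⟩ := hc.mixed.exists_transport (s := s) R (opp v) False (by
      rw [opp_opp, iff_false, not_not]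
      exact ⟨a, ha⟩)
    refine (linked_of_free (hc c' h1) R v ?_ ?_ h3.mp).mono h1.inducedGroup_le
    · rwa [h2 _ (by simpa using bond_opp_notMem_beyond R (opp v))]
    · rwa [h2 _ (d_notMem_beyond _ _)]
  · exact linked_of_free hc.mixed R v ha he hv

/-- An electron on the bond between the vertices is linked to both. If that bond is empty, an
electron is brought to the far side of `f` and pushes `f` onto it, next to `e`. -/
theorem reflTransGen_linked_neighbor (hc : Robust s c) (R : Vertex Lx Ly) (v : Dir × Bool)
    {e f : Fin N} (he : c.pos e = .d R) (hf : c.pos f = .d (R + step v)) :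
    Relation.ReflTransGen (Linked (inducedGroup s c)) e f := by
  by_cases hv : c.Occ (bond R v)
  · obtain ⟨a, ha⟩ := hv
    exact Relation.ReflTransGen.head (linked_bond hc R v ha he).symm
      (Relation.ReflTransGen.single
        (linked_bond hc (R + step v) (opp v) (by rwa [bond_add_step]) hf))
  · obtain ⟨c₁, h1, h2, h3⟩ := hc.mixed.exists_transport (s := s) (R + step v) v True (by
      rw [bond_add_step, iff_true]
      exact hv)
    obtain ⟨a, ha⟩ := h3.mpr trivial
    have he' : c₁.pos e = .d R := by
      have := d_sub_step_notMem_beyond (R + step v) v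
      rw [add_sub_cancel_right] at this
      rwa [h2 _ this]
    have hf' : c₁.pos f = .d (R + step v) := by rwa [h2 _ (d_notMem_beyond _ _)]
    have hv' : ¬ c₁.Occ (bond (R + step v) (opp v)) := by
      rwa [h2.occ_iff (bond_opp_notMem_beyond _ _), bond_add_step]
    -- On a line of length one the bonds on both sides would coincide.
    have hstep : R ≠ R + step v := by
      intro h
      rw [bond_add_step] at hv'
      rw [← h] at ha
      exact hv' ⟨a, ha⟩
    obtain ⟨c₂, h4, -, f2, k2⟩ := exists_hop s c₁ (R + step v) (opp v) (i := a) (j := f)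
      (by rwa [opp_opp]) hf' fun k hk => hv' ⟨k, hk⟩
    rw [bond_add_step] at f2
    have e2 : c₂.pos e = .d R := by
      rw [k2 e _ _, he']
      · rintro rfl
        exact bond_ne_d _ _ _ (ha.symm.trans he')
      · rintro rfl
        exact hstep (Site.d.inj (he'.symm.trans hf'))
    exact Relation.ReflTransGen.single
      ((linked_bond (hc.of_connected (h1.trans h4)) R v f2 e2).symm.mono
        (h1.trans h4).inducedGroup_le)

theorem reflTransGen_linked_nsmul (hc : Robust s c) (R : Vertex Lx Ly) (v : Dir × Bool) (n : ℕ)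
    {e f : Fin N} (he : c.pos e = .d R) (hf : c.pos f = .d (R + n • step v)) :
    Relation.ReflTransGen (Linked (inducedGroup s c)) e f := by
  induction n generalizing f with
  | zero =>
    rw [zero_nsmul, add_zero] at hf
    rw [c.injective (he.trans hf.symm)]
  | succ n ih =>
    obtain ⟨g, hg⟩ := c.d_filled (R + n • step v)
    rw [succ_nsmul, ← add_assoc] at hf
    exact (ih hg).trans (reflTransGen_linked_neighbor hc _ v hg hf)

theorem reflTransGen_linked [NeZero Lx] [NeZero Ly] (hc : Robust s c) (i j : Fin N) :
    Relation.ReflTransGen (Linked (inducedGroup s c)) i j := by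
  have hd : ∀ {R R' : Vertex Lx Ly} {e f : Fin N}, c.pos e = .d R → c.pos f = .d R' →
      Relation.ReflTransGen (Linked (inducedGroup s c)) e f := by
    intro R R' e f he hf
    obtain ⟨g, hg⟩ := c.d_filled (R + (R' - R).1.val • step (.x, true))
    refine (reflTransGen_linked_nsmul hc R _ _ he hg).trans
      (reflTransGen_linked_nsmul hc _ (.y, true) (R' - R).2.val hg ?_)
    rw [hf]
    congr 1
    ext <;> simp [step, unit]
  have hv : ∀ k, ∃ e R, c.pos e = .d R ∧
      (k = e ∨ Linked (inducedGroup s c) k e) := by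
    intro k
    cases hk : c.pos k with
    | d R => exact ⟨k, R, hk, Or.inl rfl⟩
    | p δ R =>
      obtain ⟨e, he⟩ := c.d_filled R
      exact ⟨e, R, he, Or.inr (linked_bond hc R (δ, true) hk he)⟩
  obtain ⟨e, R, he, hie⟩ := hv i
  obtain ⟨f, R', hf, hjf⟩ := hv j
  refine Relation.ReflTransGen.trans ?_ ((hd he hf).trans ?_)
  · rcases hie with rfl | h
    · exact Relation.ReflTransGen.refl
    · exact Relation.ReflTransGen.single h
  · rcases hjf with rfl | h
    · exact Relation.ReflTransGen.refl
    · exact Relation.ReflTransGen.single h.symm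

/-! ### From the line counts to mixed lines -/

theorem exists_bond_eq [NeZero Lx] [NeZero Ly] {R R' : Vertex Lx Ly} {v : Dir × Bool}
    (h : trans v.1 R' = trans v.1 R) : ∃ n : ℕ, bond (R + n • step v) v = .p v.1 R' := by
  obtain ⟨δ, b⟩ := v
  obtain ⟨R1, R2⟩ := R
  obtain ⟨R1', R2'⟩ := R'
  cases δ
  · obtain rfl : R2' = R2 := ZMod.val_injective _ h
    cases b
    -- Going backwards, the bond leaving a vertex carries the index of the preceding vertex, hence
    -- the extra -1.
    · exact ⟨(R1 - 1 - R1').val, by simp [bond, step, unit]; ring⟩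
    · exact ⟨(R1' - R1).val, by simp [bond, step, unit]⟩
  · obtain rfl : R1' = R1 := ZMod.val_injective _ h
    cases b
    · exact ⟨(R2 - 1 - R2').val, by simp [bond, step, unit]; ring⟩
    · exact ⟨(R2' - R2).val, by simp [bond, step, unit]⟩

theorem Config.occ_iff_occupation_pos {t : Site Lx Ly} : c.Occ t ↔ 0 < c.occupation t := by
  simp [Config.Occ, Config.occupation, Finset.card_pos, Finset.filter_nonempty_iff]

theorem exists_occ_iff {L : ℕ} [NeZero L] (q : ZMod L → Site Lx Ly)
    (h0 : 0 < ∑ x, c.occupation (q x)) (h1 : ∑ x, c.occupation (q x) < L) (o : Prop) :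
    ∃ x, c.Occ (q x) ↔ o := by
  by_contra hcon
  rw [not_exists] at hcon
  by_cases ho : o
  · simp only [ho, iff_true, Config.occ_iff_occupation_pos, not_lt, Nat.le_zero] at hcon
    simp [hcon] at h0
  · simp only [ho, iff_false, not_not, Config.occ_iff_occupation_pos] at hcon
    have : ∑ _x : ZMod L, 1 ≤ ∑ x, c.occupation (q x) := Finset.sum_le_sum fun x _ => hcon x
    rw [Finset.sum_const, Finset.card_univ, ZMod.card, smul_eq_mul, mul_one] at this
    omega

theorem mixed_of_bounds [NeZero Lx] [NeZero Ly] (hX : ∀ y : ZMod Ly, 0 < c.X y ∧ c.X y < Lx)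
    (hY : ∀ x : ZMod Lx, 0 < c.Y x ∧ c.Y x < Ly) : Mixed c := by
  intro R v o
  obtain ⟨R', hR', ho⟩ : ∃ R' : Vertex Lx Ly, trans v.1 R' = trans v.1 R ∧
      (c.Occ (.p v.1 R') ↔ o) := by
    obtain ⟨δ, b⟩ := v
    cases δ
    · obtain ⟨x, hx⟩ := exists_occ_iff (fun x => .p .x (x, R.2)) (hX R.2).1 (hX R.2).2 o
      exact ⟨(x, R.2), rfl, hx⟩
    · obtain ⟨y, hy⟩ := exists_occ_iff (fun y => .p .y (R.1, y)) (hY R.1).1 (hY R.1).2 o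
      exact ⟨(R.1, y), rfl, hy⟩
  obtain ⟨n, hn⟩ := exists_bond_eq hR'
  exact ⟨n, by rwa [hn]⟩

theorem Connected.X_eq [NeZero Lx] [NeZero Ly] {c' : Config Lx Ly N} (h : Connected s c c')
    (y : ZMod Ly) : c'.X y = c.X y := by
  rw [c'.X_eq_lineCount, c.X_eq_lineCount, h.conserved.1]

theorem Connected.Y_eq [NeZero Lx] [NeZero Ly] {c' : Config Lx Ly N} (h : Connected s c c')
    (x : ZMod Lx) : c'.Y x = c.Y x := by
  rw [c'.Y_eq_lineCount, c.Y_eq_lineCount, h.conserved.1]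

end LiebLattice

theorem mainTheorem10 (Lx Ly N : ℕ) [NeZero Lx] [NeZero Ly]
    (c : LiebLattice.Config Lx Ly N)
    (hrow : ∀ y : ZMod Ly, Odd (Lx + c.X y))
    (hcol : ∀ x : ZMod Lx, Odd (Ly + c.Y x))
    (hX : ∀ y : ZMod Ly, 0 < c.X y ∧ c.X y < Lx)
    (hY : ∀ x : ZMod Lx, 0 < c.Y x ∧ c.Y x < Ly) :
    LiebLattice.EvenPermutationErgodic c := by
  intro s π
  constructor
  · refine LiebLattice.sign_eq_one_of_connected fun δ R => ?_
    cases δ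
    · exact c.X_eq_lineCount R.2 ▸ hrow R.2
    · exact c.Y_eq_lineCount R.1 ▸ hcol R.1
  · intro hπ
    -- The line counts are conserved, so their strict bounds hold in every reachable configuration.
    have hrobust : LiebLattice.Robust s c := fun c' h =>
      LiebLattice.mixed_of_bounds (fun y => h.X_eq y ▸ hX y) (fun x => h.Y_eq x ▸ hY x)
    exact LiebLattice.alternatingGroup_le_of_linked _ (LiebLattice.reflTransGen_linked hrobust)
      (Equiv.Perm.mem_alternatingGroup.mpr hπ)
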